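/- Let $\mathcal G$ be a connected undirected graph on $\{1,\dots,N\}$ with positive edge weights, let $a_{ij}=a_{ji}$ be its weighted adjacency coefficients ($a_{ij}$ is the weight of the edge $\{i,j\}$, and $0$ if there is no such edge), let $L=\mathrm{diag}\big(\sum_j a_{1j},\dots,\sum_j a_{Nj}\big)-(a_{ij})$ be its Laplacian and $\lambda_N$ the largest eigenvalue of $L$. Let $\alpha,\beta,\mu,\nu>0$ and let $t_0\in\mathbb R$ be the initial time. Consider the event-triggered network of scalar single integrators $$\dot x_i=u_i,\qquad u_i=-\beta\sum_{j=1}^N a_{ij}(\hat x_i-\hat x_j),\qquad i=1,\dots,N,$$ where $\hat x_i(t)=x_i(t_k^i)$ for $t\in[t_k^i,t_{k+1}^i)$, $t_0^i=t_0$, and agent $i$ triggers whenever $f_i\ge 0$, that is, $t_{k+1}^i=\inf\{t>t_k^i : f_i(t)\ge 0\}$ with $$f_i=e_i^2-\alpha\sum_{j=1}^N a_{ij}(\hat x_i-\hat x_j)^2-\mu e^{-\nu t},\qquad e_i=\hat x_i-x_i .$$ Here $f_i$ is evaluated with the estimate $\hat x_i$ from before the update of agent $i$; if several agents trigger at the same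 instant, the updates of the other agents may reach agent $i$ before or after that evaluation, and after all updates of an instant $f_i<0$ holds for every $i$. Solutions are followed up to the first accumulation time of triggering instants, if there is one, and for all $t\ge t_0$ otherwise. Then a solution exists for every initial state $x(t_0)\in\mathbb R^N$, and every solution has the following properties. (1) It exhibits no Zeno behavior: every agent triggers only finitely often in every bounded time interval, and hence the solution exists for all $t\ge t_0$. (2) If $2\alpha\lambda_N<1$, the network reaches consensus: $x_i(t)-x_j(t)\to 0$ as $t\to\infty$ for all $i,j\in\{1,\dots,N\}$. -/

import Mathlib

open Filter Topology

/-- Adjacency matrix of the undirected graph `G` with edge weights `w`: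
`a i j` is the weight of the edge `{i, j}` if it is present, and `0` otherwise. -/
noncomputable def adjacency {N : ℕ} (G : SimpleGraph (Fin N)) (w : Sym2 (Fin N) → ℝ) :
    Matrix (Fin N) (Fin N) ℝ :=
  open Classical in Matrix.of fun i j => if G.Adj i j then w s(i, j) else 0

/-- The weighted Laplacian: diagonal matrix of the degrees `∑ j, a i j` minus the adjacency
matrix. -/
noncomputable def laplacian {N : ℕ} (G : SimpleGraph (Fin N)) (w : Sym2 (Fin N) → ℝ) :
    Matrix (Fin N) (Fin N) ℝ :=
  Matrix.diagonal (fun i => ∑ j, adjacency G w i j) - adjacency G w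

/-- The distributed control law `u i = -β ∑ j, a i j (y i - y j)`, computed from estimates `y`. -/
noncomputable def controlInput {N : ℕ} (a : Matrix (Fin N) (Fin N) ℝ) (β : ℝ)
    (y : Fin N → ℝ) (i : Fin N) : ℝ :=
  -β * ∑ j, a i j * (y i - y j)

/-- The triggering function `f i = (e i)² - α ∑ j, a i j (y i - y j)² - μ exp (-ν t)` of agent `i`
at time `t`, state `ξ` and estimates `y`, where `e i = y i - ξ i` is the sampling error. -/
noncomputable def triggerFunction {N : ℕ} (a : Matrix (Fin N) (Fin N) ℝ) (α μ ν : ℝ)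
    (t : ℝ) (ξ y : Fin N → ℝ) (i : Fin N) : ℝ :=
  (y i - ξ i) ^ 2 - α * ∑ j, a i j * (y i - y j) ^ 2 - μ * Real.exp (-ν * t)

/-- `x` (states), `xhat` (estimates) and `trig` (`trig i` is the set of triggering instants
`t₀ⁱ < t₁ⁱ < ⋯` of agent `i`) form a solution of the event-triggered closed loop on `[t0, T)`.
The right end `T` is `⊤`, or else it is the first accumulation time of triggering instants: Zeno
solutions are allowed, and followed up to the Zeno time. -/
structure IsEventTriggeredSolution {N : ℕ} (a : Matrix (Fin N) (Fin N) ℝ) (α β μ ν t0 : ℝ)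
    (T : EReal) (x xhat : ℝ → Fin N → ℝ) (trig : Fin N → Set ℝ) : Prop where
  start_lt : (t0 : EReal) < T
  /-- The initial time is the first triggering instant of each agent. -/
  start_mem : ∀ i, t0 ∈ trig i
  trig_range : ∀ i, ∀ s ∈ trig i, t0 ≤ s ∧ (s : EReal) < T
  /-- Triggering instants do not accumulate before `T`. -/
  locally_finite : ∀ i, ∀ b : ℝ, (b : EReal) < T → (trig i ∩ Set.Iic b).Finite
  /-- If `T` is finite, the triggering instants of some agent accumulate at `T`. -/
  complete : T = ⊤ ∨ ∃ i, (trig i).Infinite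
  /-- Zero-order hold: the estimate is the state at the latest triggering instant. -/
  hold : ∀ i, ∀ t : ℝ, t0 ≤ t → (t : EReal) < T →
    ∃ s, IsGreatest (trig i ∩ Set.Iic t) s ∧ xhat t i = x s i
  continuous_state : ∀ i, ContinuousOn (fun t => x t i) {t : ℝ | t0 ≤ t ∧ (t : EReal) < T}
  /-- Single integrators under the control law. The estimates jump at triggering instants and are
  continuous from the right, so the derivative is the right one. -/
  dynamics : ∀ i, ∀ t : ℝ, t0 ≤ t → (t : EReal) < T →
    HasDerivWithinAt (fun r => x r i) (controlInput a β (xhat t) i) (Set.Ici t) t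
  /-- An event happens whenever the triggering condition holds: once the updates of time `t` are
  made, no agent satisfies it any more. -/
  no_missed_event : ∀ i, ∀ t : ℝ, t0 ≤ t → (t : EReal) < T →
    triggerFunction a α μ ν t (x t) (xhat t) i < 0
  /-- An event happens only if the triggering condition holds: at a later triggering instant `s` of
  agent `i`, the triggering function is nonnegative when it is evaluated with the estimate of
  agent `i` from before its update. If another agent `j` triggers at the same instant, its update
  may reach agent `i` before or after the evaluation, so that `i` uses the new or the old value. -/
  no_spurious_event : ∀ i, ∀ s ∈ trig i, t0 < s → ∃ y : Fin N → ℝ,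
    Tendsto (fun t => xhat t i) (𝓝[<] s) (𝓝 (y i)) ∧
    (∀ j, j ≠ i → y j = xhat s j ∨ Tendsto (fun t => xhat t j) (𝓝[<] s) (𝓝 (y j))) ∧
    0 ≤ triggerFunction a α μ ν s (x s) y i

/-- Zeno behavior: some agent triggers infinitely often in bounded time. -/
def ExhibitsZeno {N : ℕ} (trig : Fin N → Set ℝ) : Prop :=
  ∃ i, ∃ b : ℝ, (trig i ∩ Set.Iic b).Infinite

/-- Consensus: `x i - x j → 0` for all agents `i`, `j`. -/
def ReachesConsensus {N : ℕ} (x : ℝ → Fin N → ℝ) : Prop :=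
  ∀ i j, Tendsto (fun t => x t i - x t j) atTop (𝓝 0)

/-! Existence: between events the inputs are constant, so the states move along straight lines and
the next event is the least point of a closed set. Simultaneous triggers are resolved by a maximal
justified set of updates (`exists_update_set`). Iterating yields a run up to the supremum of its
instants.

No Zeno: if `T` is finite, the inputs are bounded by the sup norm of past states, so the states stay
bounded (`exists_norm_state_le`). The term `μ exp (-ν t)` forces an error bounded below at each
later event, and an error starting from zero at bounded speed needs a fixed time to get there. Hence
events cannot accumulate (`finite_trig`).

Consensus: let `W` be half the sum of all squared state differences. The inputs sum to zero, and the
trigger rule bounds the disagreement of the errors by `2 α λ_N` times that of the estimates plus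
`O(exp (-ν t))`. With `2 α λ_N < 1` and the Poincaré inequality this gives `W' ≤ -c W + C exp (-ν
t)`, so `W → 0`. -/

/-! ### Updates at one instant and the next event -/

lemma triggerFunction_neg_of_eq {N : ℕ} {a : Matrix (Fin N) (Fin N) ℝ} (ha : ∀ i j, 0 ≤ a i j)
    {α μ : ℝ} (hα : 0 < α) (hμ : 0 < μ) (ν t : ℝ) {ξ y : Fin N → ℝ} {i : Fin N} (h : y i = ξ i) :
    triggerFunction a α μ ν t ξ y i < 0 := by
  have h1 : 0 ≤ ∑ j, a i j * (y i - y j) ^ 2 :=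
    Finset.sum_nonneg fun j _ => mul_nonneg (ha i j) (sq_nonneg _)
  have h2 : 0 < μ * Real.exp (-ν * t) := mul_pos hμ (Real.exp_pos _)
  have h3 := mul_nonneg hα.le h1
  have h4 : (y i - ξ i) ^ 2 = 0 := by rw [h]; ring
  unfold triggerFunction
  linarith

/-- The estimates `y` after the agents in `S` have sampled the state `ξ`. -/
def sampleOn {N : ℕ} (S : Finset (Fin N)) (ξ y : Fin N → ℝ) : Fin N → ℝ :=
  fun j => if j ∈ S then ξ j else y j

lemma sampleOn_empty {N : ℕ} (ξ y : Fin N → ℝ) : sampleOn ∅ ξ y = y := by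
  ext j; simp [sampleOn]

/-- The cascade of updates at one instant: a set `S` of agents each of which is triggered by the
updates of some others in `S`, and after whose updates nobody is triggered. -/
lemma exists_update_set {N : ℕ} {a : Matrix (Fin N) (Fin N) ℝ} (ha : ∀ i j, 0 ≤ a i j)
    {α μ : ℝ} (hα : 0 < α) (hμ : 0 < μ) (ν t : ℝ) (ξ y : Fin N → ℝ) :
    ∃ S : Finset (Fin N),
      (∀ i, triggerFunction a α μ ν t ξ (sampleOn S ξ y) i < 0) ∧
      (∀ i ∈ S, ∃ A ⊆ S, i ∉ A ∧ 0 ≤ triggerFunction a α μ ν t ξ (sampleOn A ξ y) i) := by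
  classical
  let P : Finset (Fin N) → Prop := fun S =>
    ∀ i ∈ S, ∃ A ⊆ S, i ∉ A ∧ 0 ≤ triggerFunction a α μ ν t ξ (sampleOn A ξ y) i
  -- Agents in a maximal `S` have zero error; an agent outside `S` that is still triggered could be
  -- added, with `S` itself as its witness.
  obtain ⟨S, hS⟩ := (Set.toFinite {S | P S}).exists_maximal ⟨∅, by simp [P]⟩
  refine ⟨S, fun i => ?_, hS.prop⟩
  by_cases hi : i ∈ S
  · exact triggerFunction_neg_of_eq ha hα hμ ν t (by simp [sampleOn, hi])
  · by_contra! hge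
    have hP : P (insert i S) := by
      intro j hj
      rcases Finset.mem_insert.1 hj with rfl | hj
      · exact ⟨S, Finset.subset_insert _ _, hi, hge⟩
      · obtain ⟨A, hA, h1, h2⟩ := hS.prop j hj
        exact ⟨A, hA.trans (Finset.subset_insert _ _), h1, h2⟩
    exact hi (hS.le_of_ge hP (Finset.subset_insert _ _) (Finset.mem_insert_self _ _))

/-- The states at time `s` when the estimates `y` are held from time `t` on. -/
noncomputable def holdFlow {N : ℕ} (a : Matrix (Fin N) (Fin N) ℝ) (β t : ℝ) (ξ y : Fin N → ℝ)
    (s : ℝ) : Fin N → ℝ :=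
  fun i => ξ i + (s - t) * controlInput a β y i

/-- From a state at which nobody is triggered, follow the flow up to the next event, or for a unit
of time if there is no event before. -/
lemma exists_next_event {N : ℕ} {a : Matrix (Fin N) (Fin N) ℝ} (ha : ∀ i j, 0 ≤ a i j)
    {α μ : ℝ} (hα : 0 < α) (hμ : 0 < μ) (β ν t : ℝ) (ξ y : Fin N → ℝ)
    (h : ∀ i, triggerFunction a α μ ν t ξ y i < 0) :
    ∃ (τ : ℝ) (S : Finset (Fin N)), t < τ ∧
      (∀ s ∈ Set.Ico t τ, ∀ i, triggerFunction a α μ ν s (holdFlow a β t ξ y s) y i < 0) ∧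
      (∀ i, triggerFunction a α μ ν τ (holdFlow a β t ξ y τ)
        (sampleOn S (holdFlow a β t ξ y τ) y) i < 0) ∧
      (∀ i ∈ S, ∃ A ⊆ S, i ∉ A ∧ 0 ≤ triggerFunction a α μ ν τ (holdFlow a β t ξ y τ)
        (sampleOn A (holdFlow a β t ξ y τ) y) i) ∧
      (S.Nonempty ∨ τ = t + 1) := by
  let g : Fin N → ℝ → ℝ := fun i s => triggerFunction a α μ ν s (holdFlow a β t ξ y s) y i
  have hg : ∀ i, Continuous (g i) := fun i => by
    simp only [g, triggerFunction, holdFlow]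
    fun_prop
  let E : Set ℝ := ⋃ i, {s | 0 ≤ g i s}
  have hE : IsClosed E := isClosed_iUnion_of_finite fun i => isClosed_le continuous_const (hg i)
  -- Adjoining `t + 1` makes the set nonempty, so its minimum is the first event or the end of the
  -- unit interval.
  have hK : IsCompact (Set.Icc t (t + 1) ∩ E ∪ {t + 1}) :=
    (isCompact_Icc.inter_right hE).union isCompact_singleton
  obtain ⟨τ, hτ, hmin⟩ := hK.exists_isLeast ⟨t + 1, Or.inr rfl⟩
  have hfl : holdFlow a β t ξ y t = ξ := by ext; simp [holdFlow]
  have htE : t ∉ E := by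
    simp only [E, Set.mem_iUnion, Set.mem_ofPred_eq, not_exists, not_le, g, hfl]
    exact h
  have hle : t ≤ τ := by
    rcases hτ with hτ | hτ
    · exact hτ.1.1
    · rw [Set.mem_singleton_iff.1 hτ]; linarith
  have hlt : t < τ := by
    refine lt_of_le_of_ne hle ?_
    rintro rfl
    rcases hτ with hτ | hτ
    · exact htE hτ.2
    · have := Set.mem_singleton_iff.1 hτ
      linarith
  obtain ⟨S, hS1, hS2⟩ := exists_update_set ha hα hμ ν τ (holdFlow a β t ξ y τ) y
  refine ⟨τ, S, hlt, ?_, hS1, hS2, ?_⟩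
  · intro s hs i
    by_contra! hge
    have h1 : τ ≤ t + 1 := hmin (Or.inr rfl)
    exact absurd (hmin (Or.inl ⟨⟨hs.1, hs.2.le.trans h1⟩, Set.mem_iUnion.2 ⟨i, hge⟩⟩))
      (not_le.2 hs.2)
  · rcases hτ with hτ | hτ
    · left
      obtain ⟨i, hi⟩ := Set.mem_iUnion.1 hτ.2
      -- With no update the estimates would be unchanged and the agent triggered at `τ` would remain
      -- so.
      rw [Finset.nonempty_iff_ne_empty]
      rintro rfl
      have := hS1 i
      rw [sampleOn_empty] at this
      exact absurd hi (not_le.2 this)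
    · exact Or.inr hτ

/-- An infinite run of the closed loop, as a sequence of sampling instants `t k`, states `ξ k`,
estimates `y k` and sets `S k` of updated agents. -/
structure EventRun {N : ℕ} (a : Matrix (Fin N) (Fin N) ℝ) (α β μ ν t0 : ℝ)
    (t : ℕ → ℝ) (ξ y : ℕ → Fin N → ℝ) (S : ℕ → Finset (Fin N)) : Prop where
  start : t 0 = t0
  start_set : S 0 = Finset.univ
  start_estimate : y 0 = ξ 0
  lt_succ : ∀ k, t k < t (k + 1)
  state_succ : ∀ k, ξ (k + 1) = holdFlow a β (t k) (ξ k) (y k) (t (k + 1))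
  estimate_succ : ∀ k, y (k + 1) = sampleOn (S (k + 1)) (ξ (k + 1)) (y k)
  trigger_neg : ∀ k, ∀ s ∈ Set.Ico (t k) (t (k + 1)), ∀ i,
    triggerFunction a α μ ν s (holdFlow a β (t k) (ξ k) (y k) s) (y k) i < 0
  trigger_nonneg : ∀ k, ∀ i ∈ S (k + 1), ∃ A ⊆ S (k + 1), i ∉ A ∧
    0 ≤ triggerFunction a α μ ν (t (k + 1)) (ξ (k + 1)) (sampleOn A (ξ (k + 1)) (y k)) i
  progress : ∀ k, (S (k + 1)).Nonempty ∨ t (k + 1) = t k + 1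

/-- The subtype `Q` carries the invariant that nobody is triggered, which is what permits the next
step. -/
lemma exists_eventRun {N : ℕ} {a : Matrix (Fin N) (Fin N) ℝ} (ha : ∀ i j, 0 ≤ a i j)
    {α μ : ℝ} (hα : 0 < α) (hμ : 0 < μ) (β ν t0 : ℝ) (x0 : Fin N → ℝ) :
    ∃ t ξ y S, EventRun a α β μ ν t0 t ξ y S ∧ ξ 0 = x0 := by
  let Q := {p : ℝ × (Fin N → ℝ) × (Fin N → ℝ) × Finset (Fin N) //
    ∀ i, triggerFunction a α μ ν p.1 p.2.1 p.2.2.1 i < 0}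
  choose τ S h1 h2 h3 h4 h5 using fun p : Q =>
    exists_next_event ha hα hμ β ν p.1.1 p.1.2.1 p.1.2.2.1 p.2
  let fl : Q → Fin N → ℝ := fun p => holdFlow a β p.1.1 p.1.2.1 p.1.2.2.1 (τ p)
  let next : Q → Q := fun p => ⟨(τ p, fl p, sampleOn (S p) (fl p) p.1.2.2.1, S p), h3 p⟩
  let q : ℕ → Q := fun k => Nat.rec ⟨(t0, x0, x0, Finset.univ),
    fun i => triggerFunction_neg_of_eq ha hα hμ ν t0 rfl⟩ (fun _ p => next p) k
  exact ⟨fun k => (q k).1.1, fun k => (q k).1.2.1, fun k => (q k).1.2.2.1,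
    fun k => (q k).1.2.2.2, ⟨rfl, rfl, rfl, fun k => h1 (q k), fun k => rfl, fun k => rfl,
    fun k => h2 (q k), fun k => h4 (q k), fun k => h5 (q k)⟩, rfl⟩

/-! ### From discrete runs to continuous-time solutions -/

namespace EventRun

variable {N : ℕ} {a : Matrix (Fin N) (Fin N) ℝ} {α β μ ν t0 : ℝ}
  {t : ℕ → ℝ} {ξ y : ℕ → Fin N → ℝ} {S : ℕ → Finset (Fin N)}

lemma strictMono (h : EventRun a α β μ ν t0 t ξ y S) : StrictMono t :=
  strictMono_nat_of_lt_succ h.lt_succ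

open Classical in
/-- The index of the sampling interval that contains `r`. -/
noncomputable def index (t : ℕ → ℝ) (r : ℝ) : ℕ :=
  -- The default is reached only by times beyond every node.
  if h : ∃ k, r < t (k + 1) then Nat.find h else 0

lemma index_eq (h : EventRun a α β μ ν t0 t ξ y S) {k : ℕ} {r : ℝ}
    (hr : r ∈ Set.Ico (t k) (t (k + 1))) : index t r = k := by
  classical
  have hex : ∃ k, r < t (k + 1) := ⟨k, hr.2⟩
  rw [index, dif_pos hex, Nat.find_eq_iff]
  exact ⟨hr.2, fun n hn => not_lt.2 ((h.strictMono.monotone hn).trans hr.1)⟩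

lemma exists_mem_Ico (h : EventRun a α β μ ν t0 t ξ y S) {r : ℝ} (h0 : t0 ≤ r)
    (hr : (r : EReal) < ⨆ k, (t k : EReal)) : ∃ k, r ∈ Set.Ico (t k) (t (k + 1)) := by
  classical
  obtain ⟨m, hm⟩ := lt_iSup_iff.1 hr
  have hex : ∃ k, r < t (k + 1) := ⟨m, (EReal.coe_lt_coe_iff.1 hm).trans (h.lt_succ m)⟩
  refine ⟨Nat.find hex, ?_, Nat.find_spec hex⟩
  rcases hk : Nat.find hex with _ | k
  · rwa [h.start]
  · exact not_lt.1 (Nat.find_min hex (hk ▸ Nat.lt_succ_self k))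

/-- The estimates along a run. -/
noncomputable def estimate (t : ℕ → ℝ) (y : ℕ → Fin N → ℝ) (r : ℝ) : Fin N → ℝ := y (index t r)

/-- The states along a run. -/
noncomputable def state (a : Matrix (Fin N) (Fin N) ℝ) (β : ℝ) (t : ℕ → ℝ)
    (ξ y : ℕ → Fin N → ℝ) (r : ℝ) : Fin N → ℝ :=
  holdFlow a β (t (index t r)) (ξ (index t r)) (y (index t r)) r

lemma estimate_eq (h : EventRun a α β μ ν t0 t ξ y S) {k : ℕ} {r : ℝ}
    (hr : r ∈ Set.Ico (t k) (t (k + 1))) : estimate t y r = y k := by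
  rw [estimate, h.index_eq hr]

lemma state_eq (h : EventRun a α β μ ν t0 t ξ y S) {k : ℕ} {r : ℝ}
    (hr : r ∈ Set.Ico (t k) (t (k + 1))) :
    state a β t ξ y r = holdFlow a β (t k) (ξ k) (y k) r := by
  rw [state, h.index_eq hr]

lemma state_node (h : EventRun a α β μ ν t0 t ξ y S) (k : ℕ) : state a β t ξ y (t k) = ξ k := by
  rw [h.state_eq ⟨le_rfl, h.lt_succ k⟩]; ext; simp [holdFlow]

lemma continuous_holdFlow (s : ℝ) (p q : Fin N → ℝ) : Continuous (holdFlow a β s p q) := by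
  unfold holdFlow
  fun_prop

/-- Consecutive affine pieces agree at their common node, so they glue to a continuous path. -/
lemma state_eq_Icc (h : EventRun a α β μ ν t0 t ξ y S) {k : ℕ} {r : ℝ}
    (hr : r ∈ Set.Icc (t k) (t (k + 1))) :
    state a β t ξ y r = holdFlow a β (t k) (ξ k) (y k) r := by
  rcases hr.2.lt_or_eq with h1 | rfl
  · exact h.state_eq ⟨hr.1, h1⟩
  · rw [h.state_node, h.state_succ]

lemma continuousOn_state_Icc (h : EventRun a α β μ ν t0 t ξ y S) (k : ℕ) :
    ContinuousOn (state a β t ξ y) (Set.Icc t0 (t k)) := by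
  induction k with
  | zero => rw [h.start, Set.Icc_self]; exact continuousOn_singleton _ _
  | succ k ih =>
    have h1 : ContinuousOn (state a β t ξ y) (Set.Icc (t k) (t (k + 1))) :=
      (continuous_holdFlow _ _ _).continuousOn.congr fun r hr => h.state_eq_Icc hr
    have h0 : t0 ≤ t k := h.start ▸ h.strictMono.monotone k.zero_le
    rw [← Set.Icc_union_Icc_eq_Icc h0 (h.lt_succ k).le]
    exact ih.union_of_isClosed h1 isClosed_Icc isClosed_Icc

lemma estimate_eq_last_sample (h : EventRun a α β μ ν t0 t ξ y S) (i : Fin N) (k : ℕ) :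
    ∃ m ≤ k, i ∈ S m ∧ y k i = ξ m i ∧ ∀ l ≤ k, i ∈ S l → l ≤ m := by
  induction k with
  | zero => exact ⟨0, le_rfl, by simp [h.start_set], by rw [h.start_estimate], fun l hl _ => hl⟩
  | succ k ih =>
    by_cases hi : i ∈ S (k + 1)
    · exact ⟨k + 1, le_rfl, hi, by simp [h.estimate_succ, sampleOn, hi], fun l hl _ => hl⟩
    · obtain ⟨m, hm, h1, h2, h3⟩ := ih
      refine ⟨m, hm.trans k.le_succ, h1, by simp [h.estimate_succ, sampleOn, hi, h2], ?_⟩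
      intro l hl hil
      rcases Nat.le_succ_iff.1 hl with hl | rfl
      · exact h3 l hl hil
      · exact absurd hil hi

/-- If every agent had finitely many events, all steps past some index would have length one and the
instants would be unbounded. -/
lemma iSup_eq_top_or_infinite (h : EventRun a α β μ ν t0 t ξ y S) :
    (⨆ k, (t k : EReal)) = ⊤ ∨ ∃ i, {s | ∃ k, i ∈ S k ∧ t k = s}.Infinite := by
  by_contra! hcon
  obtain ⟨hT, hfin⟩ := hcon
  have hKfin : {k | (S k).Nonempty}.Finite := by
    have h1 : (⋃ i, {s | ∃ k, i ∈ S k ∧ t k = s}).Finite :=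
      Set.finite_iUnion fun i => hfin i
    refine (h1.preimage (f := t) h.strictMono.injective.injOn).subset ?_
    rintro k ⟨i, hi⟩
    exact Set.mem_iUnion.2 ⟨i, k, hi, rfl⟩
  obtain ⟨K, hK⟩ := hKfin.bddAbove
  have hlin : ∀ n : ℕ, t (K + n) = t K + n := by
    intro n
    induction n with
    | zero => simp
    | succ n ih =>
      rcases h.progress (K + n) with h1 | h1
      · have := hK h1
        omega
      · rw [← add_assoc, h1, ih]; push_cast; ring
  apply hT
  rw [EReal.eq_top_iff_forall_lt]
  intro b
  obtain ⟨n, hn⟩ := exists_nat_gt (b - t K)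
  refine lt_of_lt_of_le ?_ (le_iSup (fun k => (t k : EReal)) (K + n))
  rw [EReal.coe_lt_coe_iff, hlin]
  linarith

theorem isEventTriggeredSolution (h : EventRun a α β μ ν t0 t ξ y S) :
    IsEventTriggeredSolution a α β μ ν t0 (⨆ k, (t k : EReal)) (state a β t ξ y)
      (estimate t y) (fun i => {s | ∃ k, i ∈ S k ∧ t k = s}) where
  start_lt := lt_of_lt_of_le (EReal.coe_lt_coe_iff.2 (h.start ▸ h.lt_succ 0))
    (le_iSup (fun k => (t k : EReal)) 1)
  start_mem i := ⟨0, by simp [h.start_set], h.start⟩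
  trig_range := by
    rintro i s ⟨k, -, rfl⟩
    exact ⟨h.start ▸ h.strictMono.monotone k.zero_le,
      lt_of_lt_of_le (EReal.coe_lt_coe_iff.2 (h.lt_succ k))
        (le_iSup (fun k => (t k : EReal)) (k + 1))⟩
  locally_finite := by
    intro i b hb
    obtain ⟨m, hm⟩ := lt_iSup_iff.1 hb
    refine ((Set.finite_lt_nat m).image t).subset ?_
    rintro s ⟨⟨k, -, rfl⟩, hk⟩
    exact ⟨k, h.strictMono.lt_iff_lt.1 (lt_of_le_of_lt hk (EReal.coe_lt_coe_iff.1 hm)), rfl⟩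
  complete := h.iSup_eq_top_or_infinite
  hold := by
    intro i r h0 hr
    obtain ⟨k, hk⟩ := h.exists_mem_Ico h0 hr
    obtain ⟨m, hm, h1, h2, h3⟩ := h.estimate_eq_last_sample i k
    refine ⟨t m, ⟨⟨⟨m, h1, rfl⟩, (h.strictMono.monotone hm).trans hk.1⟩, ?_⟩, ?_⟩
    · rintro s ⟨⟨l, hl, rfl⟩, hlr⟩
      refine h.strictMono.monotone (h3 l ?_ hl)
      exact Nat.lt_succ_iff.1 (h.strictMono.lt_iff_lt.1 (lt_of_le_of_lt hlr hk.2))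
    · rw [h.estimate_eq hk, h.state_node, h2]
  continuous_state := by
    intro i r hr
    obtain ⟨k, hk⟩ := h.exists_mem_Ico hr.1 hr.2
    have h1 : ContinuousWithinAt (state a β t ξ y) (Set.Icc t0 (t (k + 1))) r :=
      h.continuousOn_state_Icc (k + 1) r ⟨hr.1, hk.2.le⟩
    refine (continuousWithinAt_pi.1 h1 i).mono_of_mem_nhdsWithin ?_
    filter_upwards [self_mem_nhdsWithin, mem_nhdsWithin_of_mem_nhds (Iio_mem_nhds hk.2)]
      with s hs hs'
    exact ⟨hs.1, le_of_lt hs'⟩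
  dynamics := by
    intro i r h0 hr
    obtain ⟨k, hk⟩ := h.exists_mem_Ico h0 hr
    rw [h.estimate_eq hk]
    have h1 : HasDerivAt (fun s => holdFlow a β (t k) (ξ k) (y k) s i)
        (controlInput a β (y k) i) r := by
      simpa [holdFlow] using
        (((hasDerivAt_id r).sub_const (t k)).mul_const (controlInput a β (y k) i)).const_add (ξ k i)
    refine h1.hasDerivWithinAt.congr_of_eventuallyEq ?_ (by rw [h.state_eq hk])
    filter_upwards [self_mem_nhdsWithin, mem_nhdsWithin_of_mem_nhds (Iio_mem_nhds hk.2)]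
      with s hs hs'
    rw [h.state_eq ⟨hk.1.trans hs, hs'⟩]
  no_missed_event := by
    intro i r h0 hr
    obtain ⟨k, hk⟩ := h.exists_mem_Ico h0 hr
    rw [h.estimate_eq hk, h.state_eq hk]
    exact h.trigger_neg k r hk i
  no_spurious_event := by
    rintro i s ⟨k, hk, rfl⟩ h0
    rcases k with _ | k
    · exact absurd h.start h0.ne'
    obtain ⟨A, hA, hiA, hge⟩ := h.trigger_nonneg k i hk
    have hleft : ∀ j, Tendsto (fun r => estimate t y r j) (𝓝[<] t (k + 1)) (𝓝 (y k j)) := by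
      intro j
      refine tendsto_const_nhds.congr' ?_
      filter_upwards [Ioo_mem_nhdsLT (h.lt_succ k)] with r hr
      rw [h.estimate_eq ⟨hr.1.le, hr.2⟩]
    -- The updates of `A` have already reached agent `i`; all others arrive after its evaluation.
    refine ⟨sampleOn A (ξ (k + 1)) (y k), ?_, ?_, ?_⟩
    · simpa [sampleOn, hiA] using hleft i
    · intro j hj
      by_cases hjA : j ∈ A
      · left
        rw [h.estimate_eq ⟨le_rfl, h.lt_succ (k + 1)⟩, h.estimate_succ]
        simp [sampleOn, hjA, hA hjA]
      · right
        simpa [sampleOn, hjA] using hleft j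
    · rwa [h.state_node]

end EventRun

theorem exists_isEventTriggeredSolution {N : ℕ} {a : Matrix (Fin N) (Fin N) ℝ}
    (ha : ∀ i j, 0 ≤ a i j) {α μ : ℝ} (hα : 0 < α) (hμ : 0 < μ) (β ν t0 : ℝ) (x0 : Fin N → ℝ) :
    ∃ (T : EReal) (x xhat : ℝ → Fin N → ℝ) (trig : Fin N → Set ℝ),
      IsEventTriggeredSolution a α β μ ν t0 T x xhat trig ∧ x t0 = x0 := by
  obtain ⟨t, ξ, y, S, h, h0⟩ := exists_eventRun ha hα hμ β ν t0 x0
  refine ⟨_, _, _, _, h.isEventTriggeredSolution, ?_⟩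
  rw [← h0, ← h.state_node 0, h.start]

/-! ### Boundedness and exclusion of Zeno behavior -/

lemma exists_norm_controlInput_le {N : ℕ} (a : Matrix (Fin N) (Fin N) ℝ) (β : ℝ) :
    ∃ D > 0, ∀ y : Fin N → ℝ, ‖controlInput a β y‖ ≤ D * ‖y‖ := by
  have hA : 0 ≤ ∑ i, ∑ j, |a i j| :=
    Finset.sum_nonneg fun i _ => Finset.sum_nonneg fun j _ => abs_nonneg _
  -- The summand `1` makes the constant positive, since it is inverted later.
  refine ⟨|β| * ((∑ i, ∑ j, |a i j|) * 2) + 1, by positivity, fun y => ?_⟩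
  have hle : |β| * ((∑ i, ∑ j, |a i j|) * 2) * ‖y‖ ≤
      (|β| * ((∑ i, ∑ j, |a i j|) * 2) + 1) * ‖y‖ := by
    gcongr; linarith
  refine le_trans ?_ hle
  rw [pi_norm_le_iff_of_nonneg (by positivity)]
  intro i
  rw [controlInput, norm_mul, norm_neg, Real.norm_eq_abs, mul_assoc]
  refine mul_le_mul_of_nonneg_left ?_ (abs_nonneg _)
  calc ‖∑ j, a i j * (y i - y j)‖ ≤ ∑ j, |a i j| * (2 * ‖y‖) := by
        refine norm_sum_le_of_le _ fun j _ => ?_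
        rw [norm_mul, Real.norm_eq_abs]
        refine mul_le_mul_of_nonneg_left ?_ (abs_nonneg _)
        have h1 := norm_sub_le (y i) (y j)
        have h2 := norm_le_pi_norm y i
        have h3 := norm_le_pi_norm y j
        linarith
    _ = (∑ j, |a i j|) * 2 * ‖y‖ := by rw [← Finset.sum_mul]; ring
    _ ≤ (∑ i, ∑ j, |a i j|) * 2 * ‖y‖ := by
        refine mul_le_mul_of_nonneg_right (mul_le_mul_of_nonneg_right ?_ zero_le_two)
          (norm_nonneg _)
        exact Finset.single_le_sum (f := fun i => ∑ j, |a i j|)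
          (fun i _ => Finset.sum_nonneg fun j _ => abs_nonneg _) (Finset.mem_univ i)

namespace IsEventTriggeredSolution

variable {N : ℕ} {a : Matrix (Fin N) (Fin N) ℝ} {α β μ ν t0 : ℝ} {T : EReal}
  {x xhat : ℝ → Fin N → ℝ} {trig : Fin N → Set ℝ}

lemma continuousOn_Icc (h : IsEventTriggeredSolution a α β μ ν t0 T x xhat trig) {b c : ℝ}
    (hb : t0 ≤ b) (hc : (c : EReal) < T) : ContinuousOn x (Set.Icc b c) := by
  refine continuousOn_pi.2 fun i => (h.continuous_state i).mono fun _ hr => ?_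
  exact ⟨hb.trans hr.1, lt_of_le_of_lt (EReal.coe_le_coe_iff.2 hr.2) hc⟩

lemma hasDerivWithinAt (h : IsEventTriggeredSolution a α β μ ν t0 T x xhat trig) {t : ℝ}
    (ht : t0 ≤ t) (hT : (t : EReal) < T) :
    HasDerivWithinAt x (controlInput a β (xhat t)) (Set.Ici t) t :=
  hasDerivWithinAt_pi.2 fun i => h.dynamics i t ht hT

lemma norm_sub_le (h : IsEventTriggeredSolution a α β μ ν t0 T x xhat trig) {b c U : ℝ}
    (hb : t0 ≤ b) (hbc : b ≤ c) (hc : (c : EReal) < T)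
    (hU : ∀ r ∈ Set.Ico b c, ‖controlInput a β (xhat r)‖ ≤ U) : ‖x c - x b‖ ≤ U * (c - b) :=
  norm_image_sub_le_of_norm_deriv_right_le_segment (h.continuousOn_Icc hb hc)
    (fun _ hr => h.hasDerivWithinAt (hb.trans hr.1)
      ((EReal.coe_lt_coe_iff.2 hr.2).trans hc)) hU c ⟨hbc, le_rfl⟩

lemma norm_estimate_le (h : IsEventTriggeredSolution a α β μ ν t0 T x xhat trig) {b M : ℝ}
    (hb : (b : EReal) < T) (hM : ∀ r ∈ Set.Icc t0 b, ‖x r‖ ≤ M) {r : ℝ} (hr : r ∈ Set.Icc t0 b) :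
    ‖xhat r‖ ≤ M := by
  rw [pi_norm_le_iff_of_nonneg ((norm_nonneg _).trans (hM r hr))]
  intro i
  obtain ⟨s, hs, heq⟩ := h.hold i r hr.1 (lt_of_le_of_lt (EReal.coe_le_coe_iff.2 hr.2) hb)
  rw [heq]
  exact (norm_le_pi_norm _ i).trans (hM s ⟨(h.trig_range i s hs.1.1).1, le_trans hs.1.2 hr.2⟩)

/-- On a final interval of length at most `1 / (2 * D)`, the drift from `x c` to a point of maximal
norm is at most half that norm, so the maximum is at most twice the bound on `[t0, c]`. -/
lemma exists_norm_state_le {τ : ℝ}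
    (h : IsEventTriggeredSolution a α β μ ν t0 (τ : EReal) x xhat trig) :
    ∃ M, ∀ r ∈ Set.Ico t0 τ, ‖x r‖ ≤ M := by
  obtain ⟨D, hD, hu⟩ := exists_norm_controlInput_le a β
  have h0 : t0 < τ := EReal.coe_lt_coe_iff.1 h.start_lt
  set c := max t0 (τ - 1 / (2 * D)) with hc
  have hcτ : c < τ := max_lt h0 (by linarith [show 0 < 1 / (2 * D) by positivity])
  have h0c : t0 ≤ c := le_max_left _ _
  obtain ⟨M0, hM0⟩ := isCompact_Icc.exists_bound_of_continuousOn
    (h.continuousOn_Icc le_rfl (EReal.coe_lt_coe_iff.2 hcτ))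
  refine ⟨2 * M0, fun b hb => ?_⟩
  have hM0' : 0 ≤ M0 := (norm_nonneg _).trans (hM0 c ⟨h0c, le_rfl⟩)
  have hbT : ((b : ℝ) : EReal) < (τ : EReal) := EReal.coe_lt_coe_iff.2 hb.2
  obtain ⟨r, hr, hmax⟩ := isCompact_Icc.exists_isMaxOn (⟨b, hb.1, le_rfl⟩ : (Set.Icc t0 b).Nonempty)
    (h.continuousOn_Icc le_rfl hbT).norm
  have hle : ∀ s ∈ Set.Icc t0 b, ‖x s‖ ≤ ‖x r‖ := fun s hs => hmax hs
  refine (hle b ⟨hb.1, le_rfl⟩).trans ?_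
  rcases le_total r c with hrc | hrc
  · linarith [hM0 r ⟨hr.1, hrc⟩]
  · have h1 : ‖x r - x c‖ ≤ D * ‖x r‖ * (r - c) := by
      refine h.norm_sub_le h0c hrc (lt_of_le_of_lt (EReal.coe_le_coe_iff.2 hr.2) hbT) ?_
      intro s hs
      refine (hu _).trans (mul_le_mul_of_nonneg_left ?_ hD.le)
      exact h.norm_estimate_le hbT hle ⟨h0c.trans hs.1, hs.2.le.trans hr.2⟩
    have h2 : D * (r - c) ≤ 1 / 2 := by
      have h3 : r - c ≤ 1 / (2 * D) := by
        have := le_max_right t0 (τ - 1 / (2 * D))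
        linarith [hr.2, hb.2]
      calc D * (r - c) ≤ D * (1 / (2 * D)) := by gcongr
        _ = 1 / 2 := by field_simp
    have h4 : D * ‖x r‖ * (r - c) ≤ 1 / 2 * ‖x r‖ := by
      have := mul_le_mul_of_nonneg_right h2 (norm_nonneg (x r))
      linarith
    have h5 := norm_sub_norm_le (x r) (x c)
    linarith [hM0 c ⟨h0c, le_rfl⟩]

/-- At an event after the initial one, the agent has drifted by at least the threshold since its
previous event. -/
lemma exists_previous_event (h : IsEventTriggeredSolution a α β μ ν t0 T x xhat trig)
    (ha : ∀ i j, 0 ≤ a i j) (hα : 0 < α) {i : Fin N} {s s' : ℝ} (hs : s ∈ trig i)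
    (hs' : s' ∈ trig i) (hlt : s' < s) :
    ∃ p, s' ≤ p ∧ p < s ∧ t0 ≤ p ∧ μ * Real.exp (-ν * s) ≤ (x s i - x p i) ^ 2 := by
  have hsT := (h.trig_range i s hs).2
  have hfin : (trig i ∩ Set.Iio s).Finite :=
    (h.locally_finite i s hsT).subset fun r hr => ⟨hr.1, (show r < s from hr.2).le⟩
  -- The last event before `s`: its sample is the estimate held up to `s`.
  obtain ⟨p, hp, hpmax⟩ := Set.exists_max_image _ id hfin ⟨s', hs', hlt⟩
  have h0p := (h.trig_range i p hp.1).1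
  refine ⟨p, hpmax s' ⟨hs', hlt⟩, hp.2, h0p, ?_⟩
  obtain ⟨y, hy, -, hf⟩ := h.no_spurious_event i s hs (lt_of_le_of_lt h0p hp.2)
  have hyi : y i = x p i := by
    refine tendsto_nhds_unique hy (tendsto_const_nhds.congr' ?_)
    filter_upwards [Ioo_mem_nhdsLT (show p < s from hp.2)] with r hr
    obtain ⟨q, hq, heq⟩ := h.hold i r (h0p.trans hr.1.le)
      ((EReal.coe_lt_coe_iff.2 hr.2).trans hsT)
    have hqp : q = p := le_antisymm (hpmax q ⟨hq.1.1, lt_of_le_of_lt hq.1.2 hr.2⟩)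
      (hq.2 ⟨hp.1, hr.1.le⟩)
    rw [heq, hqp]
  unfold triggerFunction at hf
  have h1 : 0 ≤ α * ∑ j, a i j * (y i - y j) ^ 2 :=
    mul_nonneg hα.le (Finset.sum_nonneg fun j _ => mul_nonneg (ha i j) (sq_nonneg _))
  rw [← hyi]
  nlinarith

/-- Threshold at least `m ^ 2` before `τ` and speed at most `D * M + 1` separate events by `δ`. Thus
at most one lies in `(τ - δ, τ)`, and the earlier ones are finite in number. -/
lemma finite_trig {τ : ℝ} (h : IsEventTriggeredSolution a α β μ ν t0 (τ : EReal) x xhat trig)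
    (ha : ∀ i j, 0 ≤ a i j) (hα : 0 < α) (hμ : 0 < μ) (hν : 0 < ν) (i : Fin N) :
    (trig i).Finite := by
  obtain ⟨D, hD, hu⟩ := exists_norm_controlInput_le a β
  obtain ⟨M, hM⟩ := h.exists_norm_state_le
  have h0 : t0 < τ := EReal.coe_lt_coe_iff.1 h.start_lt
  have hM0 : 0 ≤ M := (norm_nonneg _).trans (hM t0 ⟨le_rfl, h0⟩)
  have hm : 0 < Real.sqrt (μ * Real.exp (-ν * τ)) := Real.sqrt_pos.2 (by positivity)
  set m := Real.sqrt (μ * Real.exp (-ν * τ)) with hmdef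
  have hU : 0 < D * M + 1 := by positivity
  set δ := m / (D * M + 1) with hδdef
  have hδ : 0 < δ := by positivity
  have hsep : ∀ s ∈ trig i, ∀ s' ∈ trig i, s' < s → δ ≤ s - s' := by
    intro s hs s' hs' hlt
    obtain ⟨p, h1, h2, h3, h4⟩ := h.exists_previous_event ha hα hs hs' hlt
    have hsT := (h.trig_range i s hs).2
    have hsτ : s < τ := EReal.coe_lt_coe_iff.1 hsT
    have h5 : ‖x s - x p‖ ≤ (D * M + 1) * (s - p) := by
      refine h.norm_sub_le h3 h2.le hsT fun r hr => ?_
      have := h.norm_estimate_le hsT (fun q hq => hM q ⟨hq.1, lt_of_le_of_lt hq.2 hsτ⟩)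
        (⟨h3.trans hr.1, hr.2.le⟩ : r ∈ Set.Icc t0 s)
      linarith [hu (xhat r), mul_le_mul_of_nonneg_left this hD.le]
    have h6 : m ≤ |x s i - x p i| := by
      refine Real.sqrt_le_iff.2 ⟨abs_nonneg _, ?_⟩
      rw [sq_abs]
      refine le_trans ?_ h4
      gcongr μ * Real.exp ?_
      nlinarith
    have h7 : |x s i - x p i| ≤ ‖x s - x p‖ := norm_le_pi_norm (x s - x p) i
    rw [hδdef, div_le_iff₀ hU]
    nlinarith
  have hsub : trig i ⊆ (trig i ∩ Set.Iic (τ - δ)) ∪ (trig i ∩ Set.Ioi (τ - δ)) := by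
    rw [← Set.inter_union_distrib_left, Set.Iic_union_Ioi, Set.inter_univ]
  refine Set.Finite.subset (Set.Finite.union
    (h.locally_finite i _ (EReal.coe_lt_coe_iff.2 (by linarith))) ?_) hsub
  refine Set.Subsingleton.finite ?_
  have key : ∀ s ∈ trig i ∩ Set.Ioi (τ - δ), ∀ s' ∈ trig i ∩ Set.Ioi (τ - δ), ¬ s' < s := by
    intro s hs s' hs' hlt
    have h1 := hsep s hs.1 s' hs'.1 hlt
    have h2 : s < τ := EReal.coe_lt_coe_iff.1 (h.trig_range i s hs.1).2
    have h3 : τ - δ < s' := hs'.2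
    linarith
  exact fun s hs s' hs' => le_antisymm (not_lt.1 (key s hs s' hs')) (not_lt.1 (key s' hs' s hs))

theorem eq_top (h : IsEventTriggeredSolution a α β μ ν t0 T x xhat trig)
    (ha : ∀ i j, 0 ≤ a i j) (hα : 0 < α) (hμ : 0 < μ) (hν : 0 < ν) : T = ⊤ := by
  induction T with
  | bot => exact absurd h.start_lt not_lt_bot
  | top => rfl
  | coe τ =>
    rcases h.complete with h1 | ⟨i, hi⟩
    · exact h1
    · exact absurd (h.finite_trig ha hα hμ hν i) hi

theorem not_exhibitsZeno (h : IsEventTriggeredSolution a α β μ ν t0 T x xhat trig)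
    (ha : ∀ i j, 0 ≤ a i j) (hα : 0 < α) (hμ : 0 < μ) (hν : 0 < ν) : ¬ ExhibitsZeno trig := by
  rintro ⟨i, b, hb⟩
  refine hb (h.locally_finite i b ?_)
  rw [h.eq_top ha hα hμ hν]
  exact EReal.coe_lt_top b

end IsEventTriggeredSolution

/-! ### Laplacian, disagreement and Poincaré inequality -/

lemma adjacency_symm {N : ℕ} (G : SimpleGraph (Fin N)) (w : Sym2 (Fin N) → ℝ) (i j : Fin N) :
    adjacency G w i j = adjacency G w j i := by
  by_cases h : G.Adj i j
  · simp [adjacency, h, h.symm, Sym2.eq_swap]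
  · simp [adjacency, h, show ¬ G.Adj j i from fun h1 => h h1.symm]

lemma adjacency_pos {N : ℕ} {G : SimpleGraph (Fin N)} {w : Sym2 (Fin N) → ℝ}
    (hw : ∀ e ∈ G.edgeSet, 0 < w e) {i j : Fin N} (h : G.Adj i j) : 0 < adjacency G w i j := by
  simpa [adjacency, h] using hw s(i, j) h

lemma adjacency_nonneg {N : ℕ} {G : SimpleGraph (Fin N)} {w : Sym2 (Fin N) → ℝ}
    (hw : ∀ e ∈ G.edgeSet, 0 < w e) (i j : Fin N) : 0 ≤ adjacency G w i j := by
  by_cases h : G.Adj i j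
  · exact (adjacency_pos hw h).le
  · simp [adjacency, h]

/-- The disagreement energy `∑ i j, a i j (y i - y j)²`. -/
def disagreement {N : ℕ} (a : Matrix (Fin N) (Fin N) ℝ) (y : Fin N → ℝ) : ℝ :=
  ∑ i, ∑ j, a i j * (y i - y j) ^ 2

/-- Summation by parts: swap `i` and `j` using symmetry, then add the two forms. -/
lemma sum_mul_sum_sub {N : ℕ} {a : Matrix (Fin N) (Fin N) ℝ} (hs : ∀ i j, a i j = a j i)
    (x y : Fin N → ℝ) :
    2 * ∑ i, x i * ∑ j, a i j * (y i - y j) = ∑ i, ∑ j, a i j * ((x i - x j) * (y i - y j)) := by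
  have h1 : ∑ i, x i * ∑ j, a i j * (y i - y j) = ∑ i, ∑ j, a i j * (x i * (y i - y j)) := by
    simp_rw [Finset.mul_sum]
    exact Finset.sum_congr rfl fun i _ => Finset.sum_congr rfl fun j _ => by ring
  have h2 : ∑ i, x i * ∑ j, a i j * (y i - y j) = ∑ i, ∑ j, a i j * (x j * (y j - y i)) := by
    rw [h1, Finset.sum_comm]
    exact Finset.sum_congr rfl fun i _ => Finset.sum_congr rfl fun j _ => by rw [hs j i]
  rw [two_mul]
  nth_rw 1 [h1]
  rw [h2]
  simp_rw [← Finset.sum_add_distrib]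
  exact Finset.sum_congr rfl fun i _ => Finset.sum_congr rfl fun j _ => by ring

lemma laplacian_mulVec {N : ℕ} (G : SimpleGraph (Fin N)) (w : Sym2 (Fin N) → ℝ) (y : Fin N → ℝ)
    (i : Fin N) : (laplacian G w).mulVec y i = ∑ j, adjacency G w i j * (y i - y j) := by
  rw [laplacian, Matrix.sub_mulVec, Pi.sub_apply, Matrix.mulVec_diagonal, Matrix.mulVec,
    dotProduct, Finset.sum_mul, ← Finset.sum_sub_distrib]
  exact Finset.sum_congr rfl fun j _ => by ring

lemma laplacian_isHermitian {N : ℕ} (G : SimpleGraph (Fin N)) (w : Sym2 (Fin N) → ℝ) :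
    (laplacian G w).IsHermitian := by
  refine Matrix.IsHermitian.sub (Matrix.isHermitian_diagonal _) ?_
  ext i j
  simp [adjacency_symm G w i j]

/-- The quadratic form of a Hermitian matrix is bounded by any bound of its eigenvalues. -/
lemma Matrix.IsHermitian.dotProduct_mulVec_le {n : Type*} [Fintype n] [DecidableEq n]
    {A : Matrix n n ℝ} (hA : A.IsHermitian) {c : ℝ}
    (hc : ∀ l, Module.End.HasEigenvalue (Matrix.toLin' A) l → l ≤ c) (v : n → ℝ) :
    v ⬝ᵥ A.mulVec v ≤ c * (v ⬝ᵥ v) := by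
  have hB : (c • (1 : Matrix n n ℝ) - A).IsHermitian := by
    refine Matrix.IsHermitian.sub ?_ hA
    ext i j
    simp [Matrix.one_apply, eq_comm]
  have hpsd : (c • (1 : Matrix n n ℝ) - A).PosSemidef := by
    rw [hB.posSemidef_iff_eigenvalues_nonneg]
    intro k
    have hk := hB.mulVec_eigenvectorBasis k
    have hne : (hB.eigenvectorBasis k).ofLp ≠ 0 := by
      intro h0
      have h1 := hB.eigenvectorBasis.orthonormal.ne_zero k
      exact h1 ((WithLp.ofLp_eq_zero 2).1 h0)
    -- An eigenvalue `l` of `c • 1 - A` makes `c - l` one of `A`, so `c - l ≤ c`.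
    have h2 : Module.End.HasEigenvalue (Matrix.toLin' A) (c - hB.eigenvalues k) := by
      refine Module.End.hasEigenvalue_of_hasEigenvector (x := (hB.eigenvectorBasis k).ofLp)
        ⟨Module.End.mem_eigenspace_iff.2 ?_, hne⟩
      rw [Matrix.sub_mulVec, Matrix.smul_mulVec, Matrix.one_mulVec] at hk
      rw [Matrix.toLin'_apply, sub_smul, ← hk, sub_sub_cancel]
    have := hc _ h2
    simp only [Pi.zero_apply]
    linarith
  have h := hpsd.dotProduct_mulVec_nonneg v
  rw [Matrix.sub_mulVec, Matrix.smul_mulVec, Matrix.one_mulVec, dotProduct_sub, dotProduct_smul,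
    star_trivial, smul_eq_mul] at h
  linarith

lemma disagreement_le {N : ℕ} {G : SimpleGraph (Fin N)} {w : Sym2 (Fin N) → ℝ} {c : ℝ}
    (hc : ∀ l, Module.End.HasEigenvalue (Matrix.toLin' (laplacian G w)) l → l ≤ c)
    (v : Fin N → ℝ) : disagreement (adjacency G w) v ≤ 2 * c * ∑ i, v i ^ 2 := by
  have h := (laplacian_isHermitian G w).dotProduct_mulVec_le hc v
  have h2 := sum_mul_sum_sub (adjacency_symm G w) v v
  simp only [dotProduct, laplacian_mulVec, ← sq] at h h2
  rw [disagreement, ← h2]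
  linarith

lemma hasEigenvalue_laplacian_zero {N : ℕ} [Nonempty (Fin N)] (G : SimpleGraph (Fin N))
    (w : Sym2 (Fin N) → ℝ) : Module.End.HasEigenvalue (Matrix.toLin' (laplacian G w)) 0 := by
  refine Module.End.hasEigenvalue_of_hasEigenvector (x := fun _ => 1)
    ⟨Module.End.mem_eigenspace_iff.2 ?_, fun h => ?_⟩
  · ext i
    simp [laplacian_mulVec]
  · exact one_ne_zero (congrFun h (Classical.arbitrary _))

lemma disagreement_nonneg {N : ℕ} {a : Matrix (Fin N) (Fin N) ℝ} (ha : ∀ i j, 0 ≤ a i j)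
    (y : Fin N → ℝ) : 0 ≤ disagreement a y :=
  Finset.sum_nonneg fun i _ => Finset.sum_nonneg fun j _ => mul_nonneg (ha i j) (sq_nonneg _)

lemma sum_sum_sub_sq {N : ℕ} (y : Fin N → ℝ) :
    ∑ i, ∑ j, (y i - y j) ^ 2 = 2 * (N * ∑ i, y i ^ 2 - (∑ i, y i) ^ 2) := by
  have h : ∀ i j, (y i - y j) ^ 2 = y i ^ 2 + y j ^ 2 - 2 * (y i * y j) := fun i j => by ring
  simp_rw [h, Finset.sum_sub_distrib, Finset.sum_add_distrib, ← Finset.mul_sum, ← Finset.sum_mul]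
  simp [← Finset.mul_sum]
  ring

/-- A Poincaré inequality for connected weighted graphs. -/
lemma exists_sub_sq_le_disagreement {N : ℕ} {G : SimpleGraph (Fin N)} {w : Sym2 (Fin N) → ℝ}
    (hw : ∀ e ∈ G.edgeSet, 0 < w e) {i j : Fin N} (p : G.Walk i j) :
    ∃ κ, 0 ≤ κ ∧ ∀ y : Fin N → ℝ, (y i - y j) ^ 2 ≤ κ * disagreement (adjacency G w) y := by
  have ha := adjacency_nonneg hw
  induction p with
  | nil => exact ⟨0, le_rfl, fun y => by simp⟩
  | @cons i k j hik p ih =>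
    obtain ⟨κ, hκ, hb⟩ := ih
    have hpos := adjacency_pos hw hik
    -- The factors `2` come from `(p + q)² ≤ 2 p² + 2 q²`.
    refine ⟨2 * (1 / adjacency G w i k) + 2 * κ, by positivity, fun y => ?_⟩
    have h1 : adjacency G w i k * (y i - y k) ^ 2 ≤ disagreement (adjacency G w) y := by
      refine le_trans (Finset.single_le_sum (f := fun j => adjacency G w i j * (y i - y j) ^ 2)
        (fun j _ => mul_nonneg (ha i j) (sq_nonneg _)) (Finset.mem_univ k)) ?_
      exact Finset.single_le_sum (f := fun i => ∑ j, adjacency G w i j * (y i - y j) ^ 2)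
        (fun i _ => Finset.sum_nonneg fun j _ => mul_nonneg (ha i j) (sq_nonneg _))
        (Finset.mem_univ i)
    have h2 : (y i - y k) ^ 2 ≤ 1 / adjacency G w i k * disagreement (adjacency G w) y := by
      rw [one_div, ← div_eq_inv_mul, le_div_iff₀ hpos]
      linarith
    nlinarith [hb y, sq_nonneg ((y i - y k) - (y k - y j))]

lemma exists_sum_sub_sq_le_disagreement {N : ℕ} {G : SimpleGraph (Fin N)} (hG : G.Connected)
    {w : Sym2 (Fin N) → ℝ} (hw : ∀ e ∈ G.edgeSet, 0 < w e) :
    ∃ κ, 0 < κ ∧ ∀ y : Fin N → ℝ,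
      ∑ i, ∑ j, (y i - y j) ^ 2 ≤ κ * disagreement (adjacency G w) y := by
  choose κ hκ hb using fun i j => exists_sub_sq_le_disagreement hw (hG.preconnected i j).some
  have h0 : 0 ≤ ∑ i, ∑ j, κ i j :=
    Finset.sum_nonneg fun i _ => Finset.sum_nonneg fun j _ => hκ i j
  refine ⟨∑ i, ∑ j, κ i j + 1, by positivity, fun y => ?_⟩
  have hQ := disagreement_nonneg (adjacency_nonneg hw) y
  calc ∑ i, ∑ j, (y i - y j) ^ 2
      ≤ ∑ i, ∑ j, κ i j * disagreement (adjacency G w) y :=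
        Finset.sum_le_sum fun i _ => Finset.sum_le_sum fun j _ => hb i j y
    _ = (∑ i, ∑ j, κ i j) * disagreement (adjacency G w) y := by simp_rw [Finset.sum_mul]
    _ ≤ _ := by gcongr; linarith

/-! ### Lyapunov decay and consensus -/

/-- A nonnegative function with `W' ≤ -c W + C exp (-ν t)` tends to zero. -/
lemma tendsto_zero_of_deriv_right_le {W W' : ℝ → ℝ} {t0 c C ν : ℝ} (hc : 0 < c) (hC : 0 ≤ C)
    (hν : 0 < ν) (hcont : ContinuousOn W (Set.Ici t0))
    (hderiv : ∀ t, t0 ≤ t → HasDerivWithinAt W (W' t) (Set.Ici t) t)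
    (hnonneg : ∀ t, 0 ≤ W t)
    (hle : ∀ t, t0 ≤ t → W' t ≤ -c * W t + C * Real.exp (-ν * t)) :
    Tendsto W atTop (𝓝 0) := by
  -- A rate strictly below `ν` avoids the resonant case `c = ν`.
  obtain ⟨b, hb, hbc, hbν⟩ : ∃ b, 0 < b ∧ b ≤ c ∧ b < ν :=
    ⟨min c (ν / 2), by positivity, min_le_left _ _, (min_le_right _ _).trans_lt (by linarith)⟩
  have hνb : 0 < ν - b := by linarith
  -- The second term absorbs the forcing, so `F` is nonincreasing.
  let F : ℝ → ℝ := fun t =>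
    Real.exp (b * t) * W t + C / (ν - b) * Real.exp (-(ν - b) * t)
  have hFd : ∀ t, t0 ≤ t → HasDerivWithinAt F
      (Real.exp (b * t) * (b * W t + W' t - C * Real.exp (-ν * t))) (Set.Ici t) t := by
    intro t ht
    have h1 : HasDerivAt (fun t => Real.exp (b * t)) (Real.exp (b * t) * b) t := by
      simpa using ((hasDerivAt_id t).const_mul b).exp
    have h2 : HasDerivAt (fun t => Real.exp (-(ν - b) * t))
        (Real.exp (-(ν - b) * t) * (-(ν - b))) t := by
      simpa using ((hasDerivAt_id t).const_mul (-(ν - b))).exp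
    refine ((h1.hasDerivWithinAt.mul (hderiv t ht)).add
      (h2.hasDerivWithinAt.const_mul (C / (ν - b)))).congr_deriv ?_
    have h3 : Real.exp (-(ν - b) * t) = Real.exp (b * t) * Real.exp (-ν * t) := by
      rw [← Real.exp_add]; ring_nf
    rw [h3]
    field_simp
    ring
  have hFc : ContinuousOn F (Set.Ici t0) := by
    refine ContinuousOn.add (ContinuousOn.mul ?_ hcont) ?_ <;> fun_prop
  have hbound : ∀ t, t0 ≤ t → W t ≤ F t0 * Real.exp (-(b * t)) := by
    intro t ht
    have hF : F t ≤ F t0 := by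
      refine image_le_of_deriv_right_le_deriv_boundary (B := fun _ => F t0) (B' := fun _ => 0)
        (hFc.mono Set.Icc_subset_Ici_self) (fun s hs => hFd s hs.1) le_rfl
        continuousOn_const (fun s _ => hasDerivWithinAt_const _ _ _) (fun s hs => ?_)
        (⟨ht, le_rfl⟩ : t ∈ Set.Icc t0 t)
      refine mul_nonpos_of_nonneg_of_nonpos (Real.exp_pos _).le ?_
      have := mul_le_mul_of_nonneg_right hbc (hnonneg s)
      linarith [hle s hs.1]
    have h4 : 0 ≤ C / (ν - b) * Real.exp (-(ν - b) * t) := by positivity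
    have h5 : Real.exp (b * t) * W t ≤ F t0 := by
      simp only [F] at hF ⊢
      linarith
    rw [Real.exp_neg, ← div_eq_mul_inv, le_div_iff₀ (Real.exp_pos _)]
    linarith
  have hlim : Tendsto (fun t => F t0 * Real.exp (-(b * t))) atTop (𝓝 0) := by
    have : Tendsto (fun t => Real.exp (-(b * t))) atTop (𝓝 0) :=
      Real.tendsto_exp_neg_atTop_nhds_zero.comp (tendsto_id.const_mul_atTop hb)
    simpa using this.const_mul (F t0)
  refine tendsto_of_tendsto_of_tendsto_of_le_of_le' tendsto_const_nhds hlim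
    (Eventually.of_forall hnonneg) ?_
  filter_upwards [eventually_ge_atTop t0] with t ht using hbound t ht

lemma sum_controlInput {N : ℕ} {a : Matrix (Fin N) (Fin N) ℝ} (hs : ∀ i j, a i j = a j i) (β : ℝ)
    (y : Fin N → ℝ) : ∑ i, controlInput a β y i = 0 := by
  have h := sum_mul_sum_sub hs (fun _ => 1) y
  simp at h
  simp [controlInput, ← Finset.mul_sum, h]

/-- The decay of the disagreement under the sampled control law. -/
lemma sum_mul_controlInput_le {N : ℕ} {G : SimpleGraph (Fin N)} {w : Sym2 (Fin N) → ℝ}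
    (hw : ∀ e ∈ G.edgeSet, 0 < w e) {c : ℝ}
    (hc : ∀ l, Module.End.HasEigenvalue (Matrix.toLin' (laplacian G w)) l → l ≤ c) (hc0 : 0 ≤ c)
    {α β ε : ℝ} (hα : 0 < α) (hβ : 0 < β) (hc1 : 2 * α * c < 1) (ξ y : Fin N → ℝ)
    (htrig : ∀ i, (y i - ξ i) ^ 2 - α * ∑ j, adjacency G w i j * (y i - y j) ^ 2 - ε < 0) :
    2 * ∑ i, ξ i * controlInput (adjacency G w) β y i ≤
      -(β * ((1 - 2 * α * c) / (4 * (1 + 2 * α * c)))) * disagreement (adjacency G w) ξ +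
        β * (c * N * (2 / (1 + 2 * α * c))) * ε := by
  set a := adjacency G w
  have ha : ∀ i j, 0 ≤ a i j := adjacency_nonneg hw
  have hB : 2 * ∑ i, ξ i * controlInput a β y i =
      -β * ∑ i, ∑ j, a i j * ((ξ i - ξ j) * (y i - y j)) := by
    rw [← sum_mul_sum_sub (adjacency_symm G w)]
    simp only [controlInput]
    rw [Finset.mul_sum, Finset.mul_sum, Finset.mul_sum]
    exact Finset.sum_congr rfl fun i _ => by ring
  have hQe := disagreement_le hc (fun i => y i - ξ i)
  have he : ∑ i, (y i - ξ i) ^ 2 ≤ α * disagreement a y + N * ε := by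
    calc ∑ i, (y i - ξ i) ^ 2 ≤ ∑ i, (α * ∑ j, a i j * (y i - y j) ^ 2 + ε) :=
          Finset.sum_le_sum fun i _ => by linarith [htrig i]
      _ = _ := by simp [Finset.sum_add_distrib, ← Finset.mul_sum, disagreement]
  have h1 : disagreement a y - disagreement a (fun i => y i - ξ i) ≤
      2 * ∑ i, ∑ j, a i j * ((ξ i - ξ j) * (y i - y j)) := by
    simp only [disagreement, Finset.mul_sum, ← Finset.sum_sub_distrib]
    refine Finset.sum_le_sum fun i _ => Finset.sum_le_sum fun j _ => ?_
    -- Polarization `2 Δξ Δy = Δξ² + Δy² - Δe²`, dropping `Δξ²`.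
    nlinarith [mul_nonneg (ha i j) (sq_nonneg (ξ i - ξ j))]
  have h2 : disagreement a ξ ≤
      2 * disagreement a y + 2 * disagreement a (fun i => y i - ξ i) := by
    simp only [disagreement, Finset.mul_sum, ← Finset.sum_add_distrib]
    refine Finset.sum_le_sum fun i _ => Finset.sum_le_sum fun j _ => ?_
    nlinarith [mul_nonneg (ha i j) (sq_nonneg ((y i - y j) + (y i - ξ i - (y j - ξ j))))]
  have h3 := mul_le_mul_of_nonneg_left he (mul_nonneg zero_le_two hc0)
  have hk : 0 < 1 + 2 * α * c := by positivity
  rw [hB]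
  have key : (1 - 2 * α * c) / (4 * (1 + 2 * α * c)) * disagreement a ξ -
      c * N * (2 / (1 + 2 * α * c)) * ε ≤
      ∑ i, ∑ j, a i j * ((ξ i - ξ j) * (y i - y j)) := by
    -- Combined with `h6`, the `ε` terms add up to `8 c N ε` because `(1 - 2 α c) + (1 + 2 α c) =
    -- 2`.
    have h5 : (1 - 2 * α * c) * disagreement a ξ ≤ (1 - 2 * α * c) *
        (2 * (1 + 2 * α * c) * disagreement a y + 4 * c * (N * ε)) :=
      mul_le_mul_of_nonneg_left (by linarith) (by linarith)
    have h4 : (1 - 2 * α * c) * disagreement a y - 2 * c * (N * ε) ≤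
        2 * ∑ i, ∑ j, a i j * ((ξ i - ξ j) * (y i - y j)) := by linarith
    have h6 := mul_le_mul_of_nonneg_left h4 hk.le
    have h7 : (1 - 2 * α * c) / (4 * (1 + 2 * α * c)) * disagreement a ξ -
        c * N * (2 / (1 + 2 * α * c)) * ε =
        ((1 - 2 * α * c) * disagreement a ξ - 8 * c * (N * ε)) / (4 * (1 + 2 * α * c)) := by
      field_simp
      ring
    rw [h7, div_le_iff₀ (by positivity)]
    linarith
  have := mul_le_mul_of_nonneg_left key hβ.le
  linarith

theorem IsEventTriggeredSolution.reachesConsensus {N : ℕ} {G : SimpleGraph (Fin N)}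
    (hG : G.Connected) {w : Sym2 (Fin N) → ℝ} (hw : ∀ e ∈ G.edgeSet, 0 < w e) {lamN : ℝ}
    (hlam : IsGreatest {l : ℝ | Module.End.HasEigenvalue (Matrix.toLin' (laplacian G w)) l} lamN)
    {α β μ ν t0 : ℝ} (hα : 0 < α) (hβ : 0 < β) (hμ : 0 < μ) (hν : 0 < ν)
    {x xhat : ℝ → Fin N → ℝ} {trig : Fin N → Set ℝ}
    (h : IsEventTriggeredSolution (adjacency G w) α β μ ν t0 ⊤ x xhat trig)
    (hlt : 2 * α * lamN < 1) : ReachesConsensus x := by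
  have := hG.nonempty
  have hN : 0 < N := Fin.pos_iff_nonempty.2 this
  have hNR : (0 : ℝ) < N := Nat.cast_pos.2 hN
  have hc : ∀ l, Module.End.HasEigenvalue (Matrix.toLin' (laplacian G w)) l → l ≤ lamN :=
    fun l hl => hlam.2 hl
  have hlam0 : 0 ≤ lamN := hc 0 (hasEigenvalue_laplacian_zero G w)
  obtain ⟨κ, hκ, hpoinc⟩ := exists_sum_sub_sq_le_disagreement hG hw
  -- In this form the derivative of the second term vanishes, as the inputs sum to zero.
  let W : ℝ → ℝ := fun t => N * ∑ i, x t i ^ 2 - (∑ i, x t i) ^ 2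
  have hW : ∀ t, ∑ i, ∑ j, (x t i - x t j) ^ 2 = 2 * W t := fun t => sum_sum_sub_sq (x t)
  have hpair : ∀ t i j, (x t i - x t j) ^ 2 ≤ 2 * W t := by
    intro t i j
    rw [← hW]
    refine le_trans (Finset.single_le_sum (f := fun j => (x t i - x t j) ^ 2)
      (fun j _ => sq_nonneg _) (Finset.mem_univ j)) ?_
    exact Finset.single_le_sum (f := fun i => ∑ j, (x t i - x t j) ^ 2)
      (fun i _ => Finset.sum_nonneg fun j _ => sq_nonneg _) (Finset.mem_univ i)
  have hcx : ∀ i, ContinuousOn (fun t => x t i) (Set.Ici t0) := fun i =>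
    (h.continuous_state i).mono fun t ht => ⟨ht, EReal.coe_lt_top t⟩
  have hd : 0 < 1 + 2 * α * lamN := by positivity
  have hg : 0 < 1 - 2 * α * lamN := by linarith
  have hlim : Tendsto W atTop (𝓝 0) := by
    refine tendsto_zero_of_deriv_right_le (t0 := t0) (ν := ν)
      (W' := fun t => N * (2 * ∑ i, x t i * controlInput (adjacency G w) β (xhat t) i))
      (c := N * (β * ((1 - 2 * α * lamN) / (4 * (1 + 2 * α * lamN)))) * (2 / κ))
      (C := N * (β * (lamN * N * (2 / (1 + 2 * α * lamN)))) * μ)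
      (by positivity) (by positivity) hν (by fun_prop) ?_ ?_ ?_
    · intro t ht
      have hdi := fun i => h.dynamics i t ht (EReal.coe_lt_top t)
      have h1 := HasDerivWithinAt.fun_sum (u := Finset.univ) fun i _ => (hdi i).pow 2
      have h2 := (HasDerivWithinAt.fun_sum (u := Finset.univ) fun i _ => hdi i).pow 2
      refine ((h1.const_mul (N : ℝ)).sub h2).congr_deriv ?_
      rw [sum_controlInput (adjacency_symm G w)]
      simp [Finset.mul_sum, mul_assoc]
    · intro t
      have := hpair t ⟨0, hN⟩ ⟨0, hN⟩
      simp at this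
      exact this
    · intro t ht
      have h1 := sum_mul_controlInput_le hw hc hlam0 hα hβ hlt (x t) (xhat t)
        (ε := μ * Real.exp (-ν * t)) fun i => h.no_missed_event i t ht (EReal.coe_lt_top t)
      have h2 : 2 / κ * W t ≤ disagreement (adjacency G w) (x t) := by
        rw [div_mul_eq_mul_div, div_le_iff₀ hκ, ← hW]
        linarith [hpoinc (x t)]
      have h3 := mul_le_mul_of_nonneg_left h1 hNR.le
      have h4 : 0 ≤ N * (β * ((1 - 2 * α * lamN) / (4 * (1 + 2 * α * lamN)))) := by positivity
      have h5 := mul_le_mul_of_nonneg_left h2 h4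
      linarith
  intro i j
  have hsq : Tendsto (fun t => (x t i - x t j) ^ 2) atTop (𝓝 0) :=
    squeeze_zero (fun t => sq_nonneg _) (fun t => hpair t i j) (by simpa using hlim.const_mul 2)
  have habs := hsq.sqrt
  simp only [Real.sqrt_sq_eq_abs, Real.sqrt_zero] at habs
  exact (tendsto_zero_iff_abs_tendsto_zero _).2 habs

theorem theorem2 {N : ℕ} (G : SimpleGraph (Fin N)) (hG : G.Connected)
    (w : Sym2 (Fin N) → ℝ) (hw : ∀ e ∈ G.edgeSet, 0 < w e)
    (lamN : ℝ)
    (hlam : IsGreatest {l : ℝ | Module.End.HasEigenvalue (Matrix.toLin' (laplacian G w)) l} lamN)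
    (α β μ ν t0 : ℝ) (hα : 0 < α) (hβ : 0 < β) (hμ : 0 < μ) (hν : 0 < ν) :
    (∀ x0 : Fin N → ℝ, ∃ (T : EReal) (x xhat : ℝ → Fin N → ℝ) (trig : Fin N → Set ℝ),
      IsEventTriggeredSolution (adjacency G w) α β μ ν t0 T x xhat trig ∧ x t0 = x0) ∧
    (∀ (T : EReal) (x xhat : ℝ → Fin N → ℝ) (trig : Fin N → Set ℝ),
      IsEventTriggeredSolution (adjacency G w) α β μ ν t0 T x xhat trig →
        (¬ ExhibitsZeno trig ∧ T = ⊤) ∧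
        (2 * α * lamN < 1 → ReachesConsensus x)) := by
  have ha : ∀ i j, 0 ≤ adjacency G w i j := adjacency_nonneg hw
  refine ⟨exists_isEventTriggeredSolution ha hα hμ β ν t0, fun T x xhat trig h => ?_⟩
  have hT := h.eq_top ha hα hμ hν
  refine ⟨⟨h.not_exhibitsZeno ha hα hμ hν, hT⟩, fun hlt => ?_⟩
  subst hT
  exact h.reachesConsensus hG hw hlam hα hβ hμ hν hlt
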